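/- Let $\mathbb K$ be $\mathbb R$ or $\mathbb C$, let $0\le j<h<k<n$ be integers, and let $\|\cdot\|$ be a unitarily invariant norm on $\mathbb K^{n\times n}$ (a norm with $\|UMV\|=\|M\|$ for all matrices $M$ and all unitary, resp. orthogonal, $U,V$). For a Hermitian matrix $B\in\mathbb K^{n\times n}$ let $\lambda_1(B)\ge\dots\ge\lambda_n(B)$ be its eigenvalues counted with multiplicity, put $\lambda_0(B)=\infty$, and let $x_1,\dots,x_n$ be an orthonormal basis of $\mathbb K^n$ with $Bx_i=\lambda_i(B)x_i$. For $0\le \ell\le n$ let $\mathcal X_\ell(B)$ be the span of $x_1,\dots,x_\ell$ (so $\mathcal X_0(B)=\{0\}$); it does not depend on the choice of the basis if $\lambda_\ell(B)>\lambda_{\ell+1}(B)$. Let $$\mathcal A=\{B\in\mathbb K^{n\times n}: B=B^*,\ \lambda_j(B)>\lambda_{j+1}(B),\ \lambda_k(B)>\lambda_{k+1}(B)\},$$ let $\mathcal G_{n,h}$ be the set of $h$-dimensional subspaces of $\mathbb K^n$, and for $B\in\mathcal A$ let $$f(B)=\Lambda\text{-adm}_h(B)=\{\mathcal S\in\mathcal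 G_{n,h}:\ \mathcal X_j(B)\subseteq\mathcal S\subseteq\mathcal X_k(B)\}.$$ For $\mathcal S,\mathcal T\in\mathcal G_{n,h}$ let $\Theta(\mathcal S,\mathcal T)=\mathrm{diag}(\theta_1,\dots,\theta_h)$ be the matrix of principal angles, given by $\theta_i\in[0,\pi/2]$ and $\cos\theta_i=\sigma_i(S^*T)$, where $\sigma_1\ge\dots\ge\sigma_h$ denote singular values and $S,T\in\mathbb K^{n\times h}$ have orthonormal columns spanning $\mathcal S$ and $\mathcal T$. Let $\|\sin\Theta(\mathcal S,\mathcal T)\|$ be the norm of the diagonal matrix $\sin\Theta(\mathcal S,\mathcal T)$, filled up with zeros to an $n\times n$ matrix. For $\mathfrak C,\mathfrak D\subseteq\mathcal G_{n,h}$ put $$d_H(\mathfrak C,\mathfrak D)=\max\Big\{\sup_{\mathcal C\in\mathfrak C}\inf_{\mathcal D\in\mathfrak D}\|\sin\Theta(\mathcal C,\mathcal D)\|,\ \sup_{\mathcal D\in\mathfrak D}\inf_{\mathcal C\in\mathfrak C}\|\sin\Theta(\mathcal C,\mathcal D)\|\Big\}.$$ Let $A\in\mathcal A$ and $\lambda_i=\lambda_i(A)$.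 Then the condition number $\kappa[f](A)$ of $f$ at $A$, that is, the limit below, exists and satisfies $$\kappa[f](A):=\lim_{\epsilon\to0^+}\ \sup_{\substack{B\in\mathcal A\\ 0<\|A-B\|<\epsilon}}\frac{d_H\big(\Lambda\text{-adm}_h(A),\Lambda\text{-adm}_h(B)\big)}{\|A-B\|}\ \le\ \frac1{\lambda_j-\lambda_{j+1}}+\frac1{\lambda_k-\lambda_{k+1}},$$ where the first term on the right-hand side is omitted if $j=0$. -/

import Mathlib

open Filter Topology
open scoped ENNReal

namespace LambdaAdm

noncomputable section

/-- A unitarily invariant norm on the space of `n × n` matrices over `𝕜`. -/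
structure UINorm (𝕜 : Type*) [RCLike 𝕜] (n : ℕ)
    extends Seminorm 𝕜 (Matrix (Fin n) (Fin n) 𝕜) where
  eq_zero_of_map_eq_zero : ∀ M : Matrix (Fin n) (Fin n) 𝕜, toFun M = 0 → M = 0
  unitary_invariant : ∀ U ∈ Matrix.unitaryGroup (Fin n) 𝕜, ∀ V ∈ Matrix.unitaryGroup (Fin n) 𝕜,
    ∀ M : Matrix (Fin n) (Fin n) 𝕜, toFun (U * M * V) = toFun M

/-- The value `‖M‖` of a unitarily invariant norm. -/
def UINorm.val {𝕜 : Type*} [RCLike 𝕜] {n : ℕ} (N : UINorm 𝕜 n)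
    (M : Matrix (Fin n) (Fin n) 𝕜) : ℝ :=
  N.toFun M

section Spectral

variable {𝕜 : Type*} [RCLike 𝕜] {n : ℕ} {A : Matrix (Fin n) (Fin n) 𝕜}

/-- `eigenvalue hA i` is `λ_i(A)` for `1 ≤ i ≤ n`, where `λ_1(A) ≥ … ≥ λ_n(A)` are the eigenvalues
of the Hermitian matrix `A` counted with multiplicity. The value at other `i` is never used. -/
def eigenvalue (hA : A.IsHermitian) (i : ℕ) : ℝ :=
  if h : 1 ≤ i ∧ i ≤ n then
    (Matrix.isSymmetric_toEuclideanLin_iff.mpr hA).eigenvalues finrank_euclideanSpace_fin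
      ⟨i - 1, by omega⟩
  else 0

/-- An orthonormal basis `x_1, …, x_n` (indexed from `0`) with `A x_i = λ_i x_i`, that is, the
columns of a unitary `X` in an eigendecomposition `A = X diag(λ_1, …, λ_n) X*`. -/
def eigenbasis (hA : A.IsHermitian) : OrthonormalBasis (Fin n) 𝕜 (EuclideanSpace 𝕜 (Fin n)) :=
  (Matrix.isSymmetric_toEuclideanLin_iff.mpr hA).eigenvectorBasis finrank_euclideanSpace_fin

/-- The dominant eigenspace `𝒳_ℓ(A) = span {x_1, …, x_ℓ}`; in particular `𝒳_0(A) = {0}`. It does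
not depend on the choice of the eigenbasis when there is a gap at `ℓ`, see
`eq_dominantSpace` below. -/
def dominantSpace (hA : A.IsHermitian) (ℓ : ℕ) : Submodule 𝕜 (EuclideanSpace 𝕜 (Fin n)) :=
  Submodule.span 𝕜 (eigenbasis hA '' {i : Fin n | (i : ℕ) < ℓ})

/-- `λ_ℓ(A) > λ_{ℓ+1}(A)`, with the convention `λ_0 = ∞`. -/
def HasGap (hA : A.IsHermitian) (ℓ : ℕ) : Prop :=
  ℓ = 0 ∨ eigenvalue hA (ℓ + 1) < eigenvalue hA ℓ

end Spectral

/-- The Grassmannian of `h`-dimensional subspaces of `𝕜ⁿ`. -/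
abbrev Grass (𝕜 : Type*) [RCLike 𝕜] (n h : ℕ) : Type _ :=
  {S : Submodule 𝕜 (EuclideanSpace 𝕜 (Fin n)) // Module.finrank 𝕜 S = h}

section Angles

variable {𝕜 : Type*} [RCLike 𝕜] {n : ℕ}

/-- The principal angle `θ_{i+1}(S, T) = arccos σ_{i+1}(S* T)`, for
`i < min (dim S) (dim T)`. In orthonormal bases of `T` and `S` the matrix `S* T` represents the
orthogonal projection onto `S`, restricted to `T`. -/
def principalAngle (S T : Submodule 𝕜 (EuclideanSpace 𝕜 (Fin n))) (i : ℕ) : ℝ :=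
  Real.arccos
    (LinearMap.singularValues (𝕜 := 𝕜) (E := T) (F := S)
      ((S.orthogonalProjectionOnto : EuclideanSpace 𝕜 (Fin n) →L[𝕜] S) ∘L T.subtypeL).toLinearMap i)

/-- The diagonal matrix `sin Θ(S, T)`, of order `min (dim S) (dim T)`, filled up with zeros to an
`n × n` matrix. -/
def sinTheta (S T : Submodule 𝕜 (EuclideanSpace 𝕜 (Fin n))) : Matrix (Fin n) (Fin n) 𝕜 :=
  Matrix.diagonal fun i =>
    if (i : ℕ) < min (Module.finrank 𝕜 S) (Module.finrank 𝕜 T) then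
      ((Real.sin (principalAngle S T i) : ℝ) : 𝕜)
    else 0

/-- The Hausdorff distance between sets of `h`-dimensional subspaces associated with
`(S, T) ↦ ‖sin Θ(S, T)‖`. -/
def hausdorffDist {h : ℕ} (N : UINorm 𝕜 n) (C D : Set (Grass 𝕜 n h)) : ℝ≥0∞ :=
  max (⨆ S ∈ C, ⨅ T ∈ D, ENNReal.ofReal (N.val (sinTheta S.1 T.1)))
    (⨆ T ∈ D, ⨅ S ∈ C, ENNReal.ofReal (N.val (sinTheta S.1 T.1)))

end Angles

/-- The set `𝒜` of Hermitian matrices `B` with `λ_j(B) > λ_{j+1}(B)` and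
`λ_k(B) > λ_{k+1}(B)`. -/
def gapSet (𝕜 : Type*) [RCLike 𝕜] (n j k : ℕ) : Set (Matrix (Fin n) (Fin n) 𝕜) :=
  {B | ∃ hB : B.IsHermitian, HasGap hB j ∧ HasGap hB k}

theorem gapSet.isHermitian {𝕜 : Type*} [RCLike 𝕜] {n j k : ℕ} (B : gapSet 𝕜 n j k) :
    (B : Matrix (Fin n) (Fin n) 𝕜).IsHermitian :=
  B.2.elim fun hB _ => hB

/-- The map `B ↦ Λ-adm_h(B)`, sending `B ∈ 𝒜` to the set of all `h`-dimensional subspaces `S`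
with `𝒳_j(B) ⊆ S ⊆ 𝒳_k(B)`. -/
def admissible (𝕜 : Type*) [RCLike 𝕜] (n j h k : ℕ) (B : gapSet 𝕜 n j k) :
    Set (Grass 𝕜 n h) :=
  {S | dominantSpace (gapSet.isHermitian B) j ≤ S.1 ∧
    S.1 ≤ dominantSpace (gapSet.isHermitian B) k}

section Condition

variable {𝕜 : Type*} [RCLike 𝕜] {n h : ℕ} {𝒜 : Set (Matrix (Fin n) (Fin n) 𝕜)}

/-- The supremum of `d_H(f(A), f(B)) / ‖A - B‖` over all `B ∈ 𝒜` with `0 < ‖A - B‖ < ε`. -/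
def maxQuotient (N : UINorm 𝕜 n) (f : 𝒜 → Set (Grass 𝕜 n h)) (A : 𝒜) (ε : ℝ) : ℝ≥0∞ :=
  ⨆ B : 𝒜, ⨆ _ : 0 < N.val (A.1 - B.1) ∧ N.val (A.1 - B.1) < ε,
    hausdorffDist N (f A) (f B) / ENNReal.ofReal (N.val (A.1 - B.1))

/-- `κ` is the condition number of the set-valued map `f` at `A`. -/
def IsConditionNumber (N : UINorm 𝕜 n) (f : 𝒜 → Set (Grass 𝕜 n h)) (A : 𝒜) (κ : ℝ≥0∞) :
    Prop :=
  Tendsto (fun ε : ℝ => maxQuotient N f A ε) (𝓝[>] 0) (𝓝 κ)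

end Condition

section WellDefined

variable {𝕜 : Type*} [RCLike 𝕜] {n : ℕ} {A : Matrix (Fin n) (Fin n) 𝕜}

theorem apply_eigenbasis (hA : A.IsHermitian) (i : Fin n) :
    A.toEuclideanLin (eigenbasis hA i) = (eigenvalue hA (i + 1) : 𝕜) • eigenbasis hA i := by
  simp [eigenbasis, eigenvalue, Nat.succ_le_of_lt i.2]

theorem eigenvalue_antitone (hA : A.IsHermitian) {i l : ℕ} (hi : 1 ≤ i) (hil : i ≤ l)
    (hl : l ≤ n) : eigenvalue hA l ≤ eigenvalue hA i := by
  rw [eigenvalue, eigenvalue, dif_pos ⟨hi.trans hil, hl⟩, dif_pos ⟨hi, hil.trans hl⟩]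
  apply LinearMap.IsSymmetric.eigenvalues_antitone
  simp only [Fin.mk_le_mk]
  omega

/-- When there is a gap at `ℓ`, the span of any orthonormal system `s_1, …, s_ℓ` with
`A s_i = λ_i s_i` is `𝒳_ℓ(A)`. -/
theorem eq_dominantSpace (hA : A.IsHermitian) {ℓ : ℕ} (hℓ : ℓ ≤ n)
    (hgap : HasGap hA ℓ) (s : Fin ℓ → EuclideanSpace 𝕜 (Fin n)) (hs : Orthonormal 𝕜 s)
    (hAs : ∀ i : Fin ℓ, A.toEuclideanLin (s i) = (eigenvalue hA (i + 1) : 𝕜) • s i) :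
    Submodule.span 𝕜 (Set.range s) = dominantSpace hA ℓ := by
  have hsym := Matrix.isSymmetric_toEuclideanLin_iff.mpr hA
  have key : ∀ (i : Fin ℓ) (m : Fin n), ℓ ≤ (m : ℕ) →
      inner 𝕜 (eigenbasis hA m) (s i) = 0 := by
    intro i m hm
    have hlt : eigenvalue hA (m + 1) < eigenvalue hA (i + 1) := by
      have hi := i.2
      have hm2 := m.2
      rcases hgap with h0 | hg
      · omega
      · exact ((eigenvalue_antitone hA (by omega) (by omega) (by omega)).trans_lt hg).trans_le
          (eigenvalue_antitone hA (by omega) (by omega) (by omega))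
    have h := hsym (eigenbasis hA m) (s i)
    rw [hAs, apply_eigenbasis, inner_smul_left, inner_smul_right, RCLike.conj_ofReal,
      ← sub_eq_zero, ← sub_mul, ← RCLike.ofReal_sub] at h
    rcases mul_eq_zero.mp h with h | h
    · have := RCLike.ofReal_eq_zero.mp h
      linarith
    · exact h
  have hle : Submodule.span 𝕜 (Set.range s) ≤ dominantSpace hA ℓ := by
    rw [Submodule.span_le]
    rintro _ ⟨i, rfl⟩
    rw [SetLike.mem_coe, ← (eigenbasis hA).sum_repr (s i)]
    refine Submodule.sum_mem _ fun m _ => ?_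
    by_cases hm : (m : ℕ) < ℓ
    · exact Submodule.smul_mem _ _ (Submodule.subset_span ⟨m, hm, rfl⟩)
    · rw [OrthonormalBasis.repr_apply_apply, key i m (by omega), zero_smul]
      exact Submodule.zero_mem _
  refine Submodule.eq_of_le_of_finrank_le hle ?_
  rw [finrank_span_eq_card hs.linearIndependent, Fintype.card_fin]
  have himg : eigenbasis hA '' {i : Fin n | (i : ℕ) < ℓ} =
      Set.range fun i : Fin ℓ => eigenbasis hA (Fin.castLE hℓ i) := by
    ext x
    constructor
    · rintro ⟨i, hi, rfl⟩
      exact ⟨⟨i, hi⟩, rfl⟩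
    · rintro ⟨i, rfl⟩
      exact ⟨Fin.castLE hℓ i, i.2, rfl⟩
  rw [dominantSpace, himg]
  exact (finrank_range_le_card _).trans_eq (Fintype.card_fin ℓ)

end WellDefined

end

end LambdaAdm

/-! Given an admissible `S` for `A`, a nearby admissible `T` for `B` is built in two moves
(`UINorm.exists_between`). Projecting `S` onto 𝒳_k(B) enforces the upper inclusion; the same move on
orthogonal complements enforces 𝒳_j(B) ⊆ T. Since ‖sin Θ(S, T)‖ = ‖P_{T⊥} P_S‖
(`UINorm.val_sinTheta`), the triangle inequality bounds the distance by ‖P_{𝒳_k(B)⊥} P_{𝒳_k(A)}‖ +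
‖P_{𝒳_j(B)} P_{𝒳_j(A)⊥}‖.

Each summand is a product of spectral projections for separated parts of the spectra, so Davis–Kahan
(`IsometryInvariant.spectral_separation`) bounds it by ‖A - B‖ over a mixed gap such as λ_k(A) -
λ_{k+1}(B). By Weyl's inequality the mixed gap is smaller than the gap of `A` by at most ‖A - B‖ /
c, where `c` compares the norm with the numerical radius. Exchanging `A` and `B` gives the other
half of the Hausdorff distance with the same gaps.

Hence for ‖A - B‖ < ε the quotient is at most `gapBound` at ε / c, which tends to the asserted bound
as ε → 0. The limit exists because the supremum is monotone in ε. -/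

namespace LambdaAdm

noncomputable section

/-! ### Isometry-invariant seminorms and the Davis–Kahan bound -/

section OperatorNorm

variable {𝕜 : Type*} [RCLike 𝕜] {E : Type*} [NormedAddCommGroup E] [InnerProductSpace 𝕜 E]
  {ι : Type*} [Fintype ι]

/-- The self-adjoint operator with eigenbasis `b` and eigenvalues `d`. -/
def diagOp (b : OrthonormalBasis ι 𝕜 E) (d : ι → ℝ) : E →L[𝕜] E :=
  ∑ i, (d i : 𝕜) • InnerProductSpace.rankOne 𝕜 (b i) (b i)

theorem diagOp_apply_basis (b : OrthonormalBasis ι 𝕜 E) (d : ι → ℝ) (i : ι) :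
    diagOp b d (b i) = (d i : 𝕜) • b i := by
  classical
  simp [diagOp, b.inner_eq_ite]

theorem clm_ext_basis {F : Type*} [NormedAddCommGroup F] [InnerProductSpace 𝕜 F]
    (b : OrthonormalBasis ι 𝕜 E) {L M : E →L[𝕜] F}
    (h : ∀ i, L (b i) = M (b i)) : L = M := by
  apply ContinuousLinearMap.coe_injective
  exact b.toBasis.ext (by simpa using h)

theorem diagOp_mul (b : OrthonormalBasis ι 𝕜 E) (d e : ι → ℝ) :
    diagOp b d * diagOp b e = diagOp b (fun i => d i * e i) := by
  refine clm_ext_basis b fun i => ?_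
  simp [diagOp_apply_basis, smul_smul, mul_comm]

theorem diagOp_one (b : OrthonormalBasis ι 𝕜 E) : diagOp b (fun _ => 1) = 1 :=
  clm_ext_basis b fun i => by simp [diagOp_apply_basis]

theorem inner_diagOp (b : OrthonormalBasis ι 𝕜 E) (d : ι → ℝ) (x y : E) :
    inner 𝕜 (diagOp b d x) y = inner 𝕜 x (diagOp b d y) := by
  simp only [diagOp, sum_apply, sum_inner, inner_sum,
    smul_apply, InnerProductSpace.rankOne_apply, inner_smul_left,
    inner_smul_right, RCLike.conj_ofReal, inner_conj_symm]
  exact Finset.sum_congr rfl fun i _ => by ring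

/-- Invariance of a seminorm on operators under multiplication by isometries from both sides. -/
def IsometryInvariant (ν : Seminorm 𝕜 (E →L[𝕜] E)) : Prop :=
  ∀ (U V : E ≃ₗᵢ[𝕜] E) (M : E →L[𝕜] E),
    ν ((U.toContinuousLinearEquiv : E →L[𝕜] E) * M * (V.toContinuousLinearEquiv : E →L[𝕜] E)) = ν M

variable {ν : Seminorm 𝕜 (E →L[𝕜] E)}

/-- The isometry flipping the signs of some vectors of an orthonormal basis. -/
def signIsometry (b : OrthonormalBasis ι 𝕜 E) (d : ι → ℝ) (hd : ∀ i, d i * d i = 1) :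
    E ≃ₗᵢ[𝕜] E where
  toLinearEquiv := LinearEquiv.ofInvolutive (diagOp b d).toLinearMap fun x => by
    have h : diagOp b d * diagOp b d = 1 := by
      rw [diagOp_mul, ← diagOp_one b]; simp [hd]
    exact congrArg (fun L => L x) h
  norm_map' x := by
    have h : diagOp b d * diagOp b d = 1 := by
      rw [diagOp_mul, ← diagOp_one b]; simp [hd]
    have h2 : diagOp b d (diagOp b d x) = x := congrArg (fun L => L x) h
    change ‖diagOp b d x‖ = ‖x‖
    rw [@norm_eq_sqrt_re_inner 𝕜, @norm_eq_sqrt_re_inner 𝕜 _ _ _ _ x, inner_diagOp, h2]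

theorem signIsometry_coe (b : OrthonormalBasis ι 𝕜 E) (d : ι → ℝ) (hd : ∀ i, d i * d i = 1) :
    ((signIsometry b d hd).toContinuousLinearEquiv : E →L[𝕜] E) = diagOp b d := by
  ext x; rfl

theorem diagOp_combo (b : OrthonormalBasis ι 𝕜 E) (d e : ι → ℝ) (s t : ℝ) :
    diagOp b (s • d + t • e) = (s : 𝕜) • diagOp b d + (t : 𝕜) • diagOp b e :=
  clm_ext_basis b fun i => by simp [diagOp_apply_basis, add_smul, smul_smul]

/-- The admissible `d` form a convex set, by the triangle inequality, and it contains all sign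
vectors, by invariance. The convex hull of the sign vectors is the whole cube. -/
theorem IsometryInvariant.mul_diagOp_le_one (hν : IsometryInvariant ν)
    (b : OrthonormalBasis ι 𝕜 E) (d : ι → ℝ) (hd : ∀ i, |d i| ≤ 1) (M : E →L[𝕜] E) :
    ν (diagOp b d * M) ≤ ν M ∧ ν (M * diagOp b d) ≤ ν M := by
  have hconv : Convex ℝ {d : ι → ℝ | ν (diagOp b d * M) ≤ ν M ∧ ν (M * diagOp b d) ≤ ν M} := by
    intro d hd e he s t hs ht hst
    constructor
    · rw [diagOp_combo, add_mul, smul_mul_assoc, smul_mul_assoc]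
      refine (map_add_le_add _ _ _).trans ?_
      rw [map_smul_eq_mul, map_smul_eq_mul, RCLike.norm_ofReal, RCLike.norm_ofReal,
        abs_of_nonneg hs, abs_of_nonneg ht]
      calc _ ≤ s * ν M + t * ν M := add_le_add (mul_le_mul_of_nonneg_left hd.1 hs)
            (mul_le_mul_of_nonneg_left he.1 ht)
        _ = ν M := by rw [← add_mul, hst, one_mul]
    · rw [diagOp_combo, mul_add, mul_smul_comm, mul_smul_comm]
      refine (map_add_le_add _ _ _).trans ?_
      rw [map_smul_eq_mul, map_smul_eq_mul, RCLike.norm_ofReal, RCLike.norm_ofReal,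
        abs_of_nonneg hs, abs_of_nonneg ht]
      calc _ ≤ s * ν M + t * ν M := add_le_add (mul_le_mul_of_nonneg_left hd.2 hs)
            (mul_le_mul_of_nonneg_left he.2 ht)
        _ = ν M := by rw [← add_mul, hst, one_mul]
  have hsub : (Set.univ.pi fun _ : ι => ({-1, 1} : Set ℝ)) ⊆
      {d : ι → ℝ | ν (diagOp b d * M) ≤ ν M ∧ ν (M * diagOp b d) ≤ ν M} := by
    intro e he
    have he' : ∀ i, e i * e i = 1 := by
      intro i
      have h : e i = -1 ∨ e i = 1 := he i trivial
      rcases h with h | h <;> simp [h]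
    have h1 := hν (signIsometry b e he') (LinearIsometryEquiv.refl 𝕜 E) M
    have h2 := hν (LinearIsometryEquiv.refl 𝕜 E) (signIsometry b e he') M
    have h3 : ((LinearIsometryEquiv.refl 𝕜 E).toContinuousLinearEquiv : E →L[𝕜] E) = 1 := by
      ext x; rfl
    rw [signIsometry_coe, h3] at h1 h2
    rw [mul_one] at h1
    rw [one_mul] at h2
    exact ⟨h1.le, h2.le⟩
  refine convexHull_min hsub hconv (a := d) ?_
  rw [convexHull_pi]
  intro i _
  rw [convexHull_pair, segment_eq_Icc (by norm_num)]
  exact abs_le.mp (hd i)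

theorem diagOp_smul (b : OrthonormalBasis ι 𝕜 E) (d : ι → ℝ) (s : ℝ) :
    diagOp b (fun i => s * d i) = (s : 𝕜) • diagOp b d :=
  clm_ext_basis b fun i => by simp [diagOp_apply_basis, smul_smul]

theorem diagOp_sub (b : OrthonormalBasis ι 𝕜 E) (d e : ι → ℝ) :
    diagOp b (fun i => d i - e i) = diagOp b d - diagOp b e :=
  clm_ext_basis b fun i => by simp [diagOp_apply_basis, sub_smul]

theorem IsometryInvariant.mul_diagOp_le (hν : IsometryInvariant ν)
    (b : OrthonormalBasis ι 𝕜 E) (d : ι → ℝ) {c : ℝ} (hc : 0 < c) (hd : ∀ i, |d i| ≤ c)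
    (M : E →L[𝕜] E) :
    ν (diagOp b d * M) ≤ c * ν M ∧ ν (M * diagOp b d) ≤ c * ν M := by
  have h : diagOp b d = (c : 𝕜) • diagOp b (fun i => c⁻¹ * d i) := by
    rw [← diagOp_smul]
    congr 1
    funext i
    field_simp
  have h1 := hν.mul_diagOp_le_one b (fun i => c⁻¹ * d i) (fun i => by
    rw [abs_mul, abs_of_pos (inv_pos.mpr hc), inv_mul_le_iff₀ hc]
    simpa using hd i) M
  rw [h, smul_mul_assoc, mul_smul_comm, map_smul_eq_mul, map_smul_eq_mul, RCLike.norm_ofReal,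
    abs_of_pos hc]
  exact ⟨mul_le_mul_of_nonneg_left h1.1 hc.le, mul_le_mul_of_nonneg_left h1.2 hc.le⟩

/-- Davis–Kahan: the product of spectral projections of two self-adjoint operators belonging to
separated parts of the spectrum is bounded by the distance of the operators over the gap. -/
theorem IsometryInvariant.spectral_separation (hν : IsometryInvariant ν)
    (a b : OrthonormalBasis ι 𝕜 E) (x y : ι → ℝ) (p q : ι → Prop) [DecidablePred p]
    [DecidablePred q] {α β : ℝ} (hαβ : β < α) (hx : ∀ i, q i → α ≤ x i) (hy : ∀ i, p i → y i ≤ β) :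
    (α - β) * ν (diagOp b (fun i => if p i then 1 else 0) *
      diagOp a (fun i => if q i then 1 else 0)) ≤ ν (diagOp a x - diagOp b y) := by
  set P := diagOp b (fun i => if p i then 1 else 0) with hP
  set Q := diagOp a (fun i => if q i then 1 else 0) with hQ
  set A := diagOp a x with hA
  set B := diagOp b y with hB
  -- With `r` this large, the part of the spectrum of `B` selected by `p` lies in the interval [β -
  -- 2r, β] of centre c = β - r. There |B - c| ≤ r, while A - c ≥ r + (α - β) on the range of `Q`.
  obtain ⟨r, hr, hyr⟩ : ∃ r : ℝ, 0 < r ∧ ∀ i, p i → β - 2 * r ≤ y i := by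
    refine ⟨1 + ∑ i, |y i - β|, ?_, fun i _ => ?_⟩
    · have : 0 ≤ ∑ i, |y i - β| := Finset.sum_nonneg fun _ _ => abs_nonneg _
      linarith
    · have h1 : |y i - β| ≤ ∑ i, |y i - β| :=
        Finset.single_le_sum (f := fun i => |y i - β|) (fun _ _ => abs_nonneg _) (Finset.mem_univ i)
      have h2 := neg_abs_le (y i - β)
      linarith [abs_nonneg (y i - β)]
  set c := β - r with hc
  have hQA : Q * A = A * Q := by
    rw [hQ, hA, diagOp_mul, diagOp_mul]; simp only [mul_comm]
  have hPB : P * B = B * P := by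
    rw [hP, hB, diagOp_mul, diagOp_mul]; simp only [mul_comm]
  have key : P * Q * (A - (c : 𝕜) • 1) = P * (A - B) * Q + (B - (c : 𝕜) • 1) * (P * Q) := by
    rw [mul_sub, mul_assoc P Q A, hQA, mul_sub, sub_mul, hPB, sub_mul]
    simp only [mul_assoc, smul_mul_assoc, mul_smul_comm, one_mul, mul_one]
    abel
  have hD : (B - (c : 𝕜) • 1) * (P * Q) =
      diagOp b (fun i => if p i then y i - c else 0) * (P * Q) := by
    rw [← mul_assoc, ← mul_assoc]
    congr 1
    rw [hB, hP, ← diagOp_one b, ← diagOp_smul, ← diagOp_sub, diagOp_mul, diagOp_mul]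
    congr 1
    funext i
    split_ifs <;> simp
  -- A - c is invertible on the range of `Q`, with inverse of size at most (r + (α - β))⁻¹.
  have hT : P * Q = P * Q * (A - (c : 𝕜) • 1) * diagOp a (fun i => if q i then (x i - c)⁻¹ else 0) := by
    rw [mul_assoc, mul_assoc]
    congr 1
    rw [hA, hQ, ← diagOp_one a, ← diagOp_smul, ← diagOp_sub, diagOp_mul, diagOp_mul]
    congr 1
    funext i
    split_ifs with hi
    · have := hx i hi
      rw [one_mul, mul_one, mul_inv_cancel₀]
      linarith
    · simp
  have hr' : 0 < r + (α - β) := by linarith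
  have h1 : ν (P * Q) ≤ (r + (α - β))⁻¹ * ν (P * Q * (A - (c : 𝕜) • 1)) := by
    conv_lhs => rw [hT]
    refine (hν.mul_diagOp_le a _ (inv_pos.mpr hr') (fun i => ?_) _).2
    split_ifs with hi
    · have := hx i hi
      have h0 : 0 < x i - c := by linarith
      rw [abs_of_pos (inv_pos.mpr h0)]
      exact inv_anti₀ hr' (by linarith)
    · simpa using hr'.le
  have h2 : ν (P * Q * (A - (c : 𝕜) • 1)) ≤ ν (A - B) + r * ν (P * Q) := by
    rw [key, hD]
    refine (map_add_le_add _ _ _).trans (add_le_add ?_ ?_)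
    · refine (hν.mul_diagOp_le_one a _ (fun i => ?_) _).2.trans
        (hν.mul_diagOp_le_one b _ (fun i => ?_) _).1
      · split_ifs <;> simp
      · split_ifs <;> simp
    · refine (hν.mul_diagOp_le b _ hr (fun i => ?_) _).1
      split_ifs with hi
      · rw [abs_le]
        have := hy i hi
        have := hyr i hi
        constructor <;> linarith
      · simpa using hr.le
  -- Now (r + (α - β)) ν(PQ) ≤ ν(A - B) + r ν(PQ); the auxiliary `r` cancels and the constant is 1.
  rw [← div_eq_inv_mul, le_div_iff₀ hr'] at h1
  linarith

end OperatorNorm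

/-! ### Singular values determine an invariant seminorm -/

section SingularValueDecomposition

variable {𝕜 : Type*} [RCLike 𝕜] {E : Type*} [NormedAddCommGroup E] [InnerProductSpace 𝕜 E]
  {ι : Type*} [Fintype ι]

/-- If a linear map sends an orthonormal basis to pairwise orthogonal vectors, these are multiples
of the vectors of an orthonormal basis. -/
theorem exists_orthonormalBasis_apply_eq_norm_smul {F : Type*} [NormedAddCommGroup F]
    [InnerProductSpace 𝕜 F] [FiniteDimensional 𝕜 F] (hF : Module.finrank 𝕜 F = Fintype.card ι)
    (w : ι → F) (hw : ∀ i l, i ≠ l → inner 𝕜 (w i) (w l) = 0) :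
    ∃ u : OrthonormalBasis ι 𝕜 F, ∀ i, w i = (‖w i‖ : 𝕜) • u i := by
  -- Only the nonzero vectors can be normalised; the extension to a basis fills the remaining
  -- indices arbitrarily.
  have horth : Orthonormal 𝕜 (Set.domRestrict {i | w i ≠ 0} fun i => ((‖w i‖⁻¹ : ℝ) : 𝕜) • w i) := by
    constructor
    · rintro ⟨i, hi⟩
      have : ‖w i‖ ≠ 0 := norm_ne_zero_iff.mpr hi
      simp [norm_smul, this]
    · rintro ⟨i, hi⟩ ⟨l, hl⟩ hil
      have : i ≠ l := fun h => hil (Subtype.ext h)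
      simp [inner_smul_left, inner_smul_right, hw i l this]
  obtain ⟨u, hu⟩ := horth.exists_orthonormalBasis_extension_of_card_eq hF
  refine ⟨u, fun i => ?_⟩
  by_cases hi : w i = 0
  · simp [hi]
  · have : (‖w i‖ : 𝕜) ≠ 0 := by simpa using hi
    rw [hu i hi, smul_smul]
    simp [this]

variable {ν : Seminorm 𝕜 (E →L[𝕜] E)}

/-- `M` is the diagonal operator between the isometries `v` → `e` and `e` → `u`. -/
theorem IsometryInvariant.eq_diagOp_of_apply_eq (hν : IsometryInvariant ν)
    (e v u : OrthonormalBasis ι 𝕜 E) (s : ι → ℝ) {M : E →L[𝕜] E}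
    (hM : ∀ i, M (v i) = (s i : 𝕜) • u i) : ν M = ν (diagOp e s) := by
  rw [← hν (e.equiv u (Equiv.refl ι)) (v.equiv e (Equiv.refl ι)) (diagOp e s)]
  congr 1
  refine clm_ext_basis v fun i => ?_
  change M (v i) = e.equiv u (Equiv.refl ι) (diagOp e s (v.equiv e (Equiv.refl ι) (v i)))
  rw [OrthonormalBasis.equiv_apply_basis, diagOp_apply_basis, map_smul]
  simp [hM]

theorem IsometryInvariant.eq_diagOp_norm (hν : IsometryInvariant ν) [FiniteDimensional 𝕜 E]
    (e v : OrthonormalBasis ι 𝕜 E) {M : E →L[𝕜] E}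
    (hM : ∀ i l, i ≠ l → inner 𝕜 (M (v i)) (M (v l)) = 0) :
    ν M = ν (diagOp e fun i => ‖M (v i)‖) := by
  obtain ⟨u, hu⟩ := exists_orthonormalBasis_apply_eq_norm_smul
    (Module.finrank_eq_card_basis e.toBasis) (fun i => M (v i)) hM
  exact hν.eq_diagOp_of_apply_eq e v u _ hu

/-- The eigenvectors of M*M serve as right singular vectors, since ⟨Mx, My⟩ = ⟨M*Mx, y⟩. -/
theorem inner_apply_eigenvectorBasis {F : Type*} [NormedAddCommGroup F]
    [InnerProductSpace 𝕜 F] [FiniteDimensional 𝕜 F] [FiniteDimensional 𝕜 E] {n : ℕ}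
    (hn : Module.finrank 𝕜 E = n) (M : E →ₗ[𝕜] F) (i l : Fin n) :
    inner 𝕜 (M (M.isSymmetric_adjoint_comp_self.eigenvectorBasis hn i))
      (M (M.isSymmetric_adjoint_comp_self.eigenvectorBasis hn l)) =
    if i = l then ((M.singularValues i ^ 2 : ℝ) : 𝕜) else 0 := by
  rw [← LinearMap.adjoint_inner_left, ← LinearMap.comp_apply,
    LinearMap.IsSymmetric.apply_eigenvectorBasis, inner_smul_left, RCLike.conj_ofReal,
    OrthonormalBasis.inner_eq_ite, LinearMap.sq_singularValues_fin M hn]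
  simp

/-- If M v_i = s_i u_i, then M' u_i = s_i v_i, so both operators have the same singular values. -/
theorem IsometryInvariant.eq_of_adjoint (hν : IsometryInvariant ν) [FiniteDimensional 𝕜 E]
    {M M' : E →L[𝕜] E} (h : ∀ x y, inner 𝕜 (M x) y = inner 𝕜 x (M' y)) : ν M' = ν M := by
  set v := M.toLinearMap.isSymmetric_adjoint_comp_self.eigenvectorBasis
    (rfl : Module.finrank 𝕜 E = _)
  obtain ⟨u, hu⟩ := exists_orthonormalBasis_apply_eq_norm_smul
    (Module.finrank_eq_card_basis v.toBasis) (fun i => M (v i)) fun i l hil => by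
      have := inner_apply_eigenvectorBasis (rfl : Module.finrank 𝕜 E = _) M.toLinearMap i l
      rwa [if_neg hil] at this
  rw [hν.eq_diagOp_of_apply_eq v v u _ hu]
  refine hν.eq_diagOp_of_apply_eq v u v _ fun i => ?_
  refine InnerProductSpace.ext_inner_left_basis (𝕜 := 𝕜) v.toBasis fun l => ?_
  rw [OrthonormalBasis.coe_toBasis, ← h, hu l, inner_smul_left, inner_smul_right,
    u.inner_eq_ite, v.inner_eq_ite, RCLike.conj_ofReal]
  split_ifs with hl
  · rw [hl]
  · simp

/-- Compressing `M` by the rank-one projection `p` onto `x` gives p M p = ⟨x, Mx⟩ p and does not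
increase `ν`. All rank-one orthogonal projections have the same seminorm. -/
theorem IsometryInvariant.abs_inner_le (hν : IsometryInvariant ν) [FiniteDimensional 𝕜 E]
    [DecidableEq ι] (e : OrthonormalBasis ι 𝕜 E) (o : ι) (M : E →L[𝕜] E) {x : E} (hx : ‖x‖ = 1) :
    ‖inner 𝕜 x (M x)‖ * ν (diagOp e fun i => if i = o then 1 else 0) ≤ ν M := by
  obtain ⟨b, hb⟩ := Orthonormal.exists_orthonormalBasis_extension_of_card_eq (𝕜 := 𝕜) (ι := ι)
    (Module.finrank_eq_card_basis e.toBasis) (v := fun _ => x) (s := {o}) (by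
      constructor
      · intro i; exact hx
      · intro i l hil; exact absurd (Subsingleton.elim i l) hil)
  have hbo : b o = x := hb o rfl
  set p := diagOp b fun i => if i = o then 1 else 0 with hp
  have hpe : ν (diagOp e fun i => if i = o then 1 else 0) = ν p :=
    (hν.eq_diagOp_of_apply_eq e b b _ fun i => diagOp_apply_basis b _ i).symm
  have hpx : ∀ y, p y = inner 𝕜 x y • x := by
    intro y
    simp [hp, diagOp, hbo, apply_ite, ite_smul]
  have h : p * M * p = (inner 𝕜 x (M x) : 𝕜) • p := by
    ext y
    change p (M (p y)) = inner 𝕜 x (M x) • p y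
    rw [hpx y, map_smul, map_smul, hpx, smul_comm]
  rw [hpe, ← map_smul_eq_mul, ← h]
  exact (hν.mul_diagOp_le_one b _ (fun i => by split_ifs <;> simp) _).2.trans
    (hν.mul_diagOp_le_one b _ (fun i => by split_ifs <;> simp) _).1

end SingularValueDecomposition

/-! ### Sines of principal angles as singular values of a product of projections -/

section PrincipalAngles

variable {𝕜 : Type*} [RCLike 𝕜] {E : Type*} [NormedAddCommGroup E] [InnerProductSpace 𝕜 E]
  [FiniteDimensional 𝕜 E] {n h : ℕ} {ν : Seminorm 𝕜 (E →L[𝕜] E)}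

/-- Extend `t` to a basis of the whole space. The product sends t_i to t_i - σ_i s_i and the added
vectors to 0. These images are pairwise orthogonal with squared norms 1 - σ_i², so the sines are the
singular values. -/
theorem IsometryInvariant.starProjection_orthogonal_mul_eq (hν : IsometryInvariant ν)
    (e : OrthonormalBasis (Fin n) 𝕜 E) {S T : Submodule 𝕜 E} (s : OrthonormalBasis (Fin h) 𝕜 S)
    (t : OrthonormalBasis (Fin h) 𝕜 T) (σ : ℕ → ℝ)
    (hst : ∀ i : Fin h, S.starProjection (t i) = (σ i : 𝕜) • (s i : E)) :
    ν (Sᗮ.starProjection * T.starProjection) =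
      ν (diagOp e fun i => if (i : ℕ) < h then √(1 - σ i ^ 2) else 0) := by
  have hs : ∀ i l, inner 𝕜 (s i : E) (s l : E) = if i = l then (1 : 𝕜) else 0 := fun i l => by
    rw [← Submodule.coe_inner, s.inner_eq_ite]
  have ht : ∀ i l, inner 𝕜 (t i : E) (t l : E) = if i = l then (1 : 𝕜) else 0 := fun i l => by
    rw [← Submodule.coe_inner, t.inner_eq_ite]
  have hh : h ≤ n := by
    have h1 := Module.finrank_eq_card_basis t.toBasis
    have h2 := Module.finrank_eq_card_basis e.toBasis
    have h3 := Submodule.finrank_le T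
    simp only [Fintype.card_fin] at h1 h2
    omega
  obtain ⟨v, hv⟩ := Orthonormal.exists_orthonormalBasis_extension_of_card_eq (𝕜 := 𝕜) (ι := Fin n)
    (Module.finrank_eq_card_basis e.toBasis)
    (v := fun i => if hi : (i : ℕ) < h then (t ⟨i, hi⟩ : E) else 0) (s := {i | (i : ℕ) < h}) (by
      rw [orthonormal_iff_ite]
      rintro ⟨i, hi⟩ ⟨l, hl⟩
      have hi' : (i : ℕ) < h := hi
      have hl' : (l : ℕ) < h := hl
      simp [Set.domRestrict, hi', hl', ht, Fin.ext_iff])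
  have hvT : ∀ i : Fin n, h ≤ (i : ℕ) → T.starProjection (v i) = 0 := by
    intro i hi
    rw [Submodule.starProjection_apply_eq_zero_iff, Submodule.mem_orthogonal]
    intro u hu
    have hu' : u = ((∑ l, t.repr ⟨u, hu⟩ l • t l : T) : E) := by rw [t.sum_repr]
    rw [hu', Submodule.coe_sum, sum_inner]
    refine Finset.sum_eq_zero fun l _ => ?_
    have hl : v (Fin.castLE hh l) = t l := by
      rw [hv _ (show ((Fin.castLE hh l : Fin n) : ℕ) < h from l.2)]
      simp
    rw [Submodule.coe_smul, inner_smul_left, ← hl, v.inner_eq_ite, if_neg, mul_zero]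
    rintro rfl
    exact absurd l.2 (not_lt.mpr (by simpa using hi))
  have hM : ∀ i : Fin n, (Sᗮ.starProjection * T.starProjection) (v i) =
      if hi : (i : ℕ) < h then (t ⟨i, hi⟩ : E) - (σ i : 𝕜) • (s ⟨i, hi⟩ : E) else 0 := by
    intro i
    change Sᗮ.starProjection (T.starProjection (v i)) = _
    split_ifs with hi
    · rw [hv i hi, dif_pos hi, Submodule.starProjection_eq_self_iff.mpr (t ⟨i, hi⟩).2,
        Submodule.starProjection_orthogonal_val, hst]
    · rw [hvT i (not_lt.mp hi), map_zero]
  have hts : ∀ i l, inner 𝕜 (s i : E) (t l : E) = if i = l then (σ l : 𝕜) else 0 := by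
    intro i l
    rw [← Submodule.starProjection_eq_self_iff.mpr (s i).2,
      Submodule.inner_starProjection_left_eq_right, hst, inner_smul_right, hs]
    simp
  have hts' : ∀ i l, inner 𝕜 (t i : E) (s l : E) = if i = l then (σ l : 𝕜) else 0 := by
    intro i l
    rw [← inner_conj_symm, hts]
    by_cases hil : i = l
    · simp [hil]
    · simp [hil, Ne.symm hil]
  have hinner : ∀ i l : Fin h, inner 𝕜 ((t i : E) - (σ i : 𝕜) • (s i : E))
      ((t l : E) - (σ l : 𝕜) • (s l : E)) = if i = l then ((1 - σ i ^ 2 : ℝ) : 𝕜) else 0 := by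
    intro i l
    simp only [inner_sub_left, inner_sub_right, inner_smul_left, inner_smul_right, hs, ht, hts,
      hts', RCLike.conj_ofReal]
    by_cases hil : i = l
    · subst hil
      simp only [if_true]
      push_cast
      ring
    · simp [hil]
  rw [hν.eq_diagOp_norm e v (M := Sᗮ.starProjection * T.starProjection)]
  · congr 2
    funext i
    rw [hM]
    split_ifs with hi
    · rw [@norm_eq_sqrt_re_inner 𝕜]
      have := hinner ⟨i, hi⟩ ⟨i, hi⟩
      rw [if_pos rfl] at this
      rw [this, RCLike.ofReal_re]
    · simp
  · intro i l hil
    rw [hM, hM]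
    by_cases hi : (i : ℕ) < h
    · by_cases hl : (l : ℕ) < h
      · rw [dif_pos hi, dif_pos hl]
        have := hinner ⟨i, hi⟩ ⟨l, hl⟩
        rwa [if_neg (by simpa [Fin.ext_iff] using hil)] at this
      · rw [dif_neg hl, inner_zero_right]
    · rw [dif_neg hi, inner_zero_left]

end PrincipalAngles

/-! ### The norm of sin Θ in terms of projections -/

section SinTheta

variable {𝕜 : Type*} [RCLike 𝕜] {n h : ℕ}

/-- A unitarily invariant norm, regarded as a seminorm on operators on `𝕜ⁿ`. -/
def UINorm.opSeminorm (N : UINorm 𝕜 n) :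
    Seminorm 𝕜 (EuclideanSpace 𝕜 (Fin n) →L[𝕜] EuclideanSpace 𝕜 (Fin n)) :=
  N.toSeminorm.comp
    (Matrix.toEuclideanCLM (n := Fin n) (𝕜 := 𝕜)).symm.toAlgEquiv.toLinearEquiv.toLinearMap

theorem UINorm.opSeminorm_toEuclideanCLM (N : UINorm 𝕜 n) (M : Matrix (Fin n) (Fin n) 𝕜) :
    N.opSeminorm (Matrix.toEuclideanCLM (n := Fin n) (𝕜 := 𝕜) M) = N.val M := by
  change N.toFun ((Matrix.toEuclideanCLM (n := Fin n) (𝕜 := 𝕜)).symm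
    (Matrix.toEuclideanCLM (n := Fin n) (𝕜 := 𝕜) M)) = _
  rw [StarAlgEquiv.symm_apply_apply]
  rfl

theorem toEuclideanCLM_symm_isometry_mem (U : EuclideanSpace 𝕜 (Fin n) ≃ₗᵢ[𝕜]
    EuclideanSpace 𝕜 (Fin n)) :
    (Matrix.toEuclideanCLM (n := Fin n) (𝕜 := 𝕜)).symm
      (U.toContinuousLinearEquiv : EuclideanSpace 𝕜 (Fin n) →L[𝕜] EuclideanSpace 𝕜 (Fin n)) ∈
      Matrix.unitaryGroup (Fin n) 𝕜 :=
  Unitary.map_mem (Matrix.toEuclideanCLM (n := Fin n) (𝕜 := 𝕜)).symm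
    (Unitary.linearIsometryEquiv.symm U).2

theorem UINorm.opSeminorm_invariant (N : UINorm 𝕜 n) : IsometryInvariant N.opSeminorm := by
  intro U V M
  change N.toFun ((Matrix.toEuclideanCLM (n := Fin n) (𝕜 := 𝕜)).symm _) =
    N.toFun ((Matrix.toEuclideanCLM (n := Fin n) (𝕜 := 𝕜)).symm M)
  rw [map_mul, map_mul]
  exact N.unitary_invariant _ (toEuclideanCLM_symm_isometry_mem U) _
    (toEuclideanCLM_symm_isometry_mem V) _

theorem toEuclideanCLM_diagonal (d : Fin n → ℝ) :
    Matrix.toEuclideanCLM (n := Fin n) (𝕜 := 𝕜) (Matrix.diagonal fun i => (d i : 𝕜)) =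
      diagOp (EuclideanSpace.basisFun (Fin n) 𝕜) d := by
  refine clm_ext_basis (EuclideanSpace.basisFun (Fin n) 𝕜) fun i => ?_
  rw [diagOp_apply_basis]
  ext l
  by_cases hl : l = i
  · simp [Matrix.mulVec_diagonal, hl, RCLike.real_smul_eq_coe_mul]
  · simp [Matrix.mulVec_diagonal, hl]

/-- The singular value decomposition of a linear map between spaces of the same dimension. -/
theorem exists_singularVectors {F G : Type*} [NormedAddCommGroup F] [InnerProductSpace 𝕜 F]
    [FiniteDimensional 𝕜 F] [NormedAddCommGroup G] [InnerProductSpace 𝕜 G] [FiniteDimensional 𝕜 G]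
    (hF : Module.finrank 𝕜 F = h) (hG : Module.finrank 𝕜 G = h) (P : F →ₗ[𝕜] G) :
    ∃ (s : OrthonormalBasis (Fin h) 𝕜 G) (t : OrthonormalBasis (Fin h) 𝕜 F),
      ∀ i : Fin h, P (t i) = (P.singularValues i : 𝕜) • s i := by
  have hin := inner_apply_eigenvectorBasis hF P
  obtain ⟨s, hs⟩ := exists_orthonormalBasis_apply_eq_norm_smul (𝕜 := 𝕜) (F := G) (ι := Fin h)
    (by simpa using hG) (fun i => P (P.isSymmetric_adjoint_comp_self.eigenvectorBasis hF i))
    (fun i l hil => by rw [hin, if_neg hil])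
  refine ⟨s, P.isSymmetric_adjoint_comp_self.eigenvectorBasis hF, fun i => ?_⟩
  rw [hs i, @norm_eq_sqrt_re_inner 𝕜, hin, if_pos rfl, RCLike.ofReal_re,
    Real.sqrt_sq (P.singularValues_nonneg _)]

theorem exists_principalVectors {S T : Submodule 𝕜 (EuclideanSpace 𝕜 (Fin n))}
    (hS : Module.finrank 𝕜 S = h) (hT : Module.finrank 𝕜 T = h) :
    ∃ (s : OrthonormalBasis (Fin h) 𝕜 S) (t : OrthonormalBasis (Fin h) 𝕜 T) (σ : ℕ → ℝ),
      (∀ i : Fin h, S.starProjection (t i) = (σ i : 𝕜) • (s i : EuclideanSpace 𝕜 (Fin n))) ∧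
      ∀ i, principalAngle S T i = Real.arccos (σ i) := by
  obtain ⟨s, t, hst⟩ := exists_singularVectors (𝕜 := 𝕜) (F := T) (G := S) hT hS
    ((S.orthogonalProjectionOnto : EuclideanSpace 𝕜 (Fin n) →L[𝕜] S) ∘L T.subtypeL).toLinearMap
  refine ⟨s, t, fun i => LinearMap.singularValues (𝕜 := 𝕜) (E := T) (F := S)
    ((S.orthogonalProjectionOnto : EuclideanSpace 𝕜 (Fin n) →L[𝕜] S) ∘L T.subtypeL).toLinearMap i,
    fun i => ?_, fun i => ?_⟩
  · have := congrArg Subtype.val (hst i)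
    rw [Submodule.coe_smul] at this
    exact this
  · rw [principalAngle]

/-- The adjoint relation to `hst`: it lets `S` and `T` exchange roles with the same cosines. -/
theorem starProjection_apply_principalVectors {E : Type*} [NormedAddCommGroup E]
    [InnerProductSpace 𝕜 E] [FiniteDimensional 𝕜 E] {S T : Submodule 𝕜 E}
    (s : OrthonormalBasis (Fin h) 𝕜 S) (t : OrthonormalBasis (Fin h) 𝕜 T) (σ : ℕ → ℝ)
    (hst : ∀ i : Fin h, S.starProjection (t i) = (σ i : 𝕜) • (s i : E)) (i : Fin h) :
    T.starProjection (s i) = (σ i : 𝕜) • (t i : E) := by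
  have h1 : T.starProjection (s i) = (T.orthogonalProjectionOnto (s i : E) : E) := rfl
  rw [h1, ← Submodule.coe_smul]
  congr 1
  refine InnerProductSpace.ext_inner_left_basis (𝕜 := 𝕜) t.toBasis fun l => ?_
  rw [OrthonormalBasis.coe_toBasis, Submodule.coe_inner, ← h1,
    ← Submodule.inner_starProjection_left_eq_right,
    Submodule.starProjection_eq_self_iff.mpr (t l).2,
    ← Submodule.starProjection_eq_self_iff.mpr (s i).2,
    ← Submodule.inner_starProjection_left_eq_right, hst, inner_smul_left, inner_smul_right,
    ← Submodule.coe_inner, s.inner_eq_ite, t.inner_eq_ite, RCLike.conj_ofReal]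
  split_ifs with hl
  · rw [hl]
  · simp

theorem UINorm.val_sinTheta (N : UINorm 𝕜 n) {S T : Submodule 𝕜 (EuclideanSpace 𝕜 (Fin n))}
    (hS : Module.finrank 𝕜 S = h) (hT : Module.finrank 𝕜 T = h) :
    N.val (sinTheta S T) = N.opSeminorm (Sᗮ.starProjection * T.starProjection) ∧
    N.val (sinTheta S T) = N.opSeminorm (Tᗮ.starProjection * S.starProjection) := by
  obtain ⟨s, t, σ, hst, hangle⟩ := exists_principalVectors hS hT
  have hsin : sinTheta S T = Matrix.diagonal fun i : Fin n =>
      ((if (i : ℕ) < h then √(1 - σ i ^ 2) else 0 : ℝ) : 𝕜) := by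
    simp only [sinTheta, hS, hT, min_self, hangle, Real.sin_arccos, apply_ite, RCLike.ofReal_zero]
  rw [hsin, ← N.opSeminorm_toEuclideanCLM, toEuclideanCLM_diagonal,
    N.opSeminorm_invariant.starProjection_orthogonal_mul_eq _ s t σ hst,
    N.opSeminorm_invariant.starProjection_orthogonal_mul_eq _ t s σ
      (starProjection_apply_principalVectors s t σ hst)]
  exact ⟨rfl, rfl⟩

end SinTheta

/-! ### Moving a subspace between two nested pairs -/

section Geometry

variable {𝕜 : Type*} [RCLike 𝕜] {n h : ℕ}

/-- An orthogonal projection is the mean of the identity and a reflection, both isometries. -/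
theorem IsometryInvariant.starProjection_mul_le {E : Type*} [NormedAddCommGroup E]
    [InnerProductSpace 𝕜 E] [FiniteDimensional 𝕜 E] {ν : Seminorm 𝕜 (E →L[𝕜] E)}
    (hν : IsometryInvariant ν) (K : Submodule 𝕜 E) (M : E →L[𝕜] E) :
    ν (K.starProjection * M) ≤ ν M ∧ ν (M * K.starProjection) ≤ ν M := by
  set R : E →L[𝕜] E := (K.reflection.toContinuousLinearEquiv : E →L[𝕜] E) with hR
  have hP : K.starProjection = (2⁻¹ : 𝕜) • (1 + R) := by
    ext x
    have h1 : R x = 2 • K.starProjection x - x := K.reflection_apply x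
    simp only [smul_apply, add_apply, one_apply_eq_self, h1]
    rw [add_sub_cancel, two_smul, ← two_smul 𝕜, smul_smul, inv_mul_cancel₀ two_ne_zero, one_smul]
  have h1 : ((LinearIsometryEquiv.refl 𝕜 E).toContinuousLinearEquiv : E →L[𝕜] E) = 1 := by
    ext x; rfl
  have hl := hν K.reflection (LinearIsometryEquiv.refl 𝕜 E) M
  have hr := hν (LinearIsometryEquiv.refl 𝕜 E) K.reflection M
  rw [h1, mul_one] at hl
  rw [h1, one_mul] at hr
  have h2 : ‖(2⁻¹ : 𝕜)‖ = 2⁻¹ := by simp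
  rw [hP, smul_mul_assoc, mul_smul_comm, map_smul_eq_mul, map_smul_eq_mul, h2, add_mul, mul_add,
    one_mul, mul_one]
  have h3 := map_add_le_add ν M (R * M)
  have h4 := map_add_le_add ν M (M * R)
  constructor <;> linarith

theorem starProjection_mul_starProjection_of_le {E : Type*} [NormedAddCommGroup E]
    [InnerProductSpace 𝕜 E] [FiniteDimensional 𝕜 E] {K L : Submodule 𝕜 E} (hKL : K ≤ L) :
    L.starProjection * K.starProjection = K.starProjection := by
  ext x
  exact Submodule.starProjection_eq_self_iff.mpr (hKL (K.starProjection_apply_mem x))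

theorem UINorm.opSeminorm_starProjection_orthogonal_comm (N : UINorm 𝕜 n)
    {S T : Submodule 𝕜 (EuclideanSpace 𝕜 (Fin n))} (h : Module.finrank 𝕜 S = Module.finrank 𝕜 T) :
    N.opSeminorm (Sᗮ.starProjection * T.starProjection) =
      N.opSeminorm (Tᗮ.starProjection * S.starProjection) :=
  (N.val_sinTheta h rfl).1.symm.trans (N.val_sinTheta h rfl).2

theorem finrank_map_of_forall_eq_zero {E : Type*} [NormedAddCommGroup E]
    [InnerProductSpace 𝕜 E] [FiniteDimensional 𝕜 E] (K : Submodule 𝕜 E) (f : E →ₗ[𝕜] E)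
    (hf : ∀ x ∈ K, f x = 0 → x = 0) : Module.finrank 𝕜 (K.map f) = Module.finrank 𝕜 K := by
  have hinj : Function.Injective (f.domRestrict K) := by
    rw [← LinearMap.ker_eq_bot, LinearMap.ker_eq_bot']
    intro x hx
    exact Subtype.ext (hf x x.2 hx)
  rw [← LinearMap.range_domRestrict]
  exact LinearMap.finrank_range_of_inj hinj

/-- A subspace between `Xj` and `Xk` can be moved to a subspace between `Yj` and `Yk`; the distance
is at most the sum of the distances of `Xk` to `Yk` and of `Xj` to `Yj`. -/
theorem UINorm.exists_between (N : UINorm 𝕜 n)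
    {Xj Xk Yj Yk S : Submodule 𝕜 (EuclideanSpace 𝕜 (Fin n))} (hY : Yj ≤ Yk) (hjS : Xj ≤ S)
    (hSk : S ≤ Xk) (hk : ∀ x ∈ Xk, x ∈ Ykᗮ → x = 0) (hj : ∀ y ∈ Yj, y ∈ Xjᗮ → y = 0) :
    ∃ T : Submodule 𝕜 (EuclideanSpace 𝕜 (Fin n)), Yj ≤ T ∧ T ≤ Yk ∧
      Module.finrank 𝕜 T = Module.finrank 𝕜 S ∧
      N.opSeminorm (Tᗮ.starProjection * S.starProjection) ≤
        N.opSeminorm (Yj.starProjection * Xjᗮ.starProjection) +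
        N.opSeminorm (Ykᗮ.starProjection * Xk.starProjection) := by
  have hν := N.opSeminorm_invariant
  set S₁ := S.map Yk.starProjection.toLinearMap with hS₁
  -- Just as `S` is projected onto `Yk`, the complement of `S₁` is projected onto the complement of
  -- `Yj`. Equivalently (`hmem`), `T` is the preimage of `S₁` under the projection onto `Yjᗮ`; this
  -- makes both inclusions visible.
  set T := (S₁ᗮ.map Yjᗮ.starProjection.toLinearMap)ᗮ with hT
  have hS₁k : S₁ ≤ Yk := by
    rintro _ ⟨x, _, rfl⟩
    exact Yk.starProjection_apply_mem x
  have hmem : ∀ w, w ∈ T ↔ Yjᗮ.starProjection w ∈ S₁ := by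
    intro w
    rw [← Submodule.orthogonal_orthogonal S₁, hT, Submodule.mem_orthogonal,
      Submodule.mem_orthogonal]
    constructor
    · intro H u hu
      rw [← Submodule.inner_starProjection_left_eq_right]
      exact H _ ⟨u, hu, rfl⟩
    · rintro H _ ⟨u, hu, rfl⟩
      have := H u hu
      rwa [← Submodule.inner_starProjection_left_eq_right] at this
  -- The first move keeps a trace of Xj ≤ S: the projection of `Xj` onto `Yk` lies in `S₁`. This
  -- makes the second move injective and bounds its cost.
  have hproj : ∀ u ∈ S₁ᗮ, Yk.starProjection u ∈ Xjᗮ := by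
    intro u hu
    rw [Submodule.mem_orthogonal]
    intro x hx
    rw [← Submodule.inner_starProjection_left_eq_right]
    exact (Submodule.mem_orthogonal _ _).mp hu _ ⟨x, hjS hx, rfl⟩
  have hrank₁ : Module.finrank 𝕜 S₁ = Module.finrank 𝕜 S := by
    refine finrank_map_of_forall_eq_zero S _ fun x hx h0 => hk x (hSk hx) ?_
    exact (Submodule.starProjection_apply_eq_zero_iff _).mp h0
  have hrank : Module.finrank 𝕜 T = Module.finrank 𝕜 S₁ := by
    have h1 : Module.finrank 𝕜 (S₁ᗮ.map Yjᗮ.starProjection.toLinearMap) =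
        Module.finrank 𝕜 S₁ᗮ := by
      refine finrank_map_of_forall_eq_zero _ _ fun u hu h0 => ?_
      have huj : u ∈ Yj := by
        have := (Submodule.starProjection_apply_eq_zero_iff _).mp h0
        rwa [Submodule.orthogonal_orthogonal] at this
      have := hproj u hu
      rw [Submodule.starProjection_eq_self_iff.mpr (hY huj)] at this
      exact hj u huj this
    have h2 := (S₁ᗮ.map Yjᗮ.starProjection.toLinearMap).finrank_add_finrank_orthogonal
    have h3 := S₁.finrank_add_finrank_orthogonal
    rw [← hT] at h2
    omega
  have bound₁ : N.opSeminorm (S₁ᗮ.starProjection * S.starProjection) ≤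
      N.opSeminorm (Ykᗮ.starProjection * Xk.starProjection) := by
    -- The `Yk`-component of a vector of `S` lies in `S₁`, so only its `Ykᗮ`-component survives.
    have : S₁ᗮ.starProjection * S.starProjection =
        S₁ᗮ.starProjection * (Ykᗮ.starProjection * Xk.starProjection * S.starProjection) := by
      rw [mul_assoc, starProjection_mul_starProjection_of_le hSk]
      ext1 x
      change S₁ᗮ.starProjection (S.starProjection x) =
        S₁ᗮ.starProjection (Ykᗮ.starProjection (S.starProjection x))
      have h0 : S₁ᗮ.starProjection (Yk.starProjection (S.starProjection x)) = 0 := by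
        rw [Submodule.starProjection_apply_eq_zero_iff, Submodule.orthogonal_orthogonal]
        exact ⟨_, S.starProjection_apply_mem x, rfl⟩
      rw [Submodule.starProjection_orthogonal_val (K := Yk), map_sub, h0, sub_zero]
    rw [this]
    exact (hν.starProjection_mul_le _ _).1.trans (hν.starProjection_mul_le _ _).2
  have bound₂ : N.opSeminorm (Tᗮ.starProjection * S₁.starProjection) ≤
      N.opSeminorm (Yj.starProjection * Xjᗮ.starProjection) := by
    rw [N.opSeminorm_starProjection_orthogonal_comm hrank]
    have hadj : N.opSeminorm (S₁ᗮ.starProjection * T.starProjection) =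
        N.opSeminorm (T.starProjection * S₁ᗮ.starProjection) := by
      refine hν.eq_of_adjoint fun x y => ?_
      change inner 𝕜 (T.starProjection (S₁ᗮ.starProjection x)) y =
        inner 𝕜 x (S₁ᗮ.starProjection (T.starProjection y))
      rw [Submodule.inner_starProjection_left_eq_right, Submodule.inner_starProjection_left_eq_right]
    -- For `u` in `S₁ᗮ` the `Yjᗮ`-component is orthogonal to `T`, so P_T u = P_T P_{Yj} u. Then
    -- P_{Yj} u = P_{Yj} P_{Yk} u by `hY`, and P_{Yk} u lies in `Xjᗮ` by `hproj`.
    have hfac : T.starProjection * S₁ᗮ.starProjection = T.starProjection *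
        (Yj.starProjection * Xjᗮ.starProjection * (Yk.starProjection * S₁ᗮ.starProjection)) := by
      ext1 x
      change T.starProjection (S₁ᗮ.starProjection x) = T.starProjection (Yj.starProjection
        (Xjᗮ.starProjection (Yk.starProjection (S₁ᗮ.starProjection x))))
      have hu := S₁ᗮ.starProjection_apply_mem x
      set u := S₁ᗮ.starProjection x
      rw [Submodule.starProjection_eq_self_iff.mpr (hproj u hu)]
      have h1 : Yj.starProjection (Yk.starProjection u) = Yj.starProjection u := by
        have := Submodule.starProjection_comp_starProjection_of_le hY
        exact congrArg (fun L => L u) this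
      have h2 : T.starProjection (Yjᗮ.starProjection u) = 0 := by
        rw [Submodule.starProjection_apply_eq_zero_iff, hT, Submodule.orthogonal_orthogonal]
        exact ⟨u, hu, rfl⟩
      rw [Submodule.starProjection_orthogonal_val (K := Yj), map_sub, sub_eq_zero] at h2
      rw [h1, h2]
    rw [hadj, hfac, ← mul_assoc (Yj.starProjection * Xjᗮ.starProjection)]
    exact (hν.starProjection_mul_le _ _).1.trans ((hν.starProjection_mul_le _ _).2.trans
      (hν.starProjection_mul_le _ _).2)
  refine ⟨T, ?_, ?_, hrank.trans hrank₁, ?_⟩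
  · intro y hy
    rw [hmem, (Submodule.starProjection_apply_eq_zero_iff _).mpr]
    · exact S₁.zero_mem
    · rwa [Submodule.orthogonal_orthogonal]
  · intro w hw
    rw [← Yj.starProjection_add_starProjection_orthogonal w]
    exact Yk.add_mem (hY (Yj.starProjection_apply_mem w)) (hS₁k ((hmem w).mp hw))
  · have hsplit : Tᗮ.starProjection * S.starProjection =
        Tᗮ.starProjection * S₁.starProjection * S.starProjection +
        Tᗮ.starProjection * (S₁ᗮ.starProjection * S.starProjection) := by
      ext1 x
      change Tᗮ.starProjection (S.starProjection x) =
        Tᗮ.starProjection (S₁.starProjection (S.starProjection x)) +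
        Tᗮ.starProjection (S₁ᗮ.starProjection (S.starProjection x))
      rw [← map_add, Submodule.starProjection_add_starProjection_orthogonal]
    rw [hsplit]
    exact (map_add_le_add _ _ _).trans (add_le_add
      ((hν.starProjection_mul_le _ _).2.trans bound₂)
      ((hν.starProjection_mul_le _ _).1.trans bound₁))

end Geometry

/-! ### Spectral perturbation: Weyl's inequality and sine bounds -/

section Perturbation

variable {𝕜 : Type*} [RCLike 𝕜] {n : ℕ} {A B : Matrix (Fin n) (Fin n) 𝕜}

theorem toEuclideanCLM_eq_diagOp (hA : A.IsHermitian) :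
    Matrix.toEuclideanCLM (n := Fin n) (𝕜 := 𝕜) A =
      diagOp (eigenbasis hA) (fun i => eigenvalue hA (i + 1)) :=
  clm_ext_basis (eigenbasis hA) fun i => by
    rw [diagOp_apply_basis, ← apply_eigenbasis hA i]
    rfl

theorem eigenbasis_mem_dominantSpace_orthogonal (hA : A.IsHermitian) {ℓ : ℕ} {i : Fin n}
    (hi : ℓ ≤ (i : ℕ)) : eigenbasis hA i ∈ (dominantSpace hA ℓ)ᗮ := by
  rw [dominantSpace, Submodule.mem_orthogonal]
  intro u hu
  induction hu using Submodule.span_induction with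
  | mem x hx =>
    obtain ⟨l, hl, rfl⟩ := hx
    have hl' : (l : ℕ) < ℓ := hl
    rw [(eigenbasis hA).inner_eq_ite, if_neg]
    rintro rfl
    omega
  | zero => simp
  | add x y _ _ hx hy => rw [inner_add_left, hx, hy, add_zero]
  | smul c x _ hx => rw [inner_smul_left, hx, mul_zero]

theorem starProjection_dominantSpace (hA : A.IsHermitian) (ℓ : ℕ) :
    (dominantSpace hA ℓ).starProjection =
      diagOp (eigenbasis hA) (fun i => if (i : ℕ) < ℓ then 1 else 0) := by
  refine clm_ext_basis (eigenbasis hA) fun i => ?_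
  rw [diagOp_apply_basis]
  split_ifs with hi
  · rw [RCLike.ofReal_one, one_smul, Submodule.starProjection_eq_self_iff]
    exact Submodule.subset_span ⟨i, hi, rfl⟩
  · rw [RCLike.ofReal_zero, zero_smul, Submodule.starProjection_apply_eq_zero_iff]
    exact eigenbasis_mem_dominantSpace_orthogonal hA (not_lt.mp hi)

theorem starProjection_dominantSpace_orthogonal (hA : A.IsHermitian) (ℓ : ℕ) :
    (dominantSpace hA ℓ)ᗮ.starProjection =
      diagOp (eigenbasis hA) (fun i => if ℓ ≤ (i : ℕ) then 1 else 0) := by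
  refine clm_ext_basis (eigenbasis hA) fun i => ?_
  rw [diagOp_apply_basis]
  split_ifs with hi
  · rw [RCLike.ofReal_one, one_smul, Submodule.starProjection_eq_self_iff]
    exact eigenbasis_mem_dominantSpace_orthogonal hA hi
  · rw [RCLike.ofReal_zero, zero_smul, Submodule.starProjection_apply_eq_zero_iff,
      Submodule.orthogonal_orthogonal]
    exact Submodule.subset_span ⟨i, not_le.mp hi, rfl⟩

theorem finrank_dominantSpace (hA : A.IsHermitian) {ℓ : ℕ} (hℓ : ℓ ≤ n) :
    Module.finrank 𝕜 (dominantSpace hA ℓ) = ℓ := by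
  have himg : eigenbasis hA '' {i : Fin n | (i : ℕ) < ℓ} =
      Set.range fun i : Fin ℓ => eigenbasis hA (Fin.castLE hℓ i) := by
    ext x
    constructor
    · rintro ⟨i, hi, rfl⟩
      exact ⟨⟨i, hi⟩, rfl⟩
    · rintro ⟨i, rfl⟩
      exact ⟨Fin.castLE hℓ i, i.2, rfl⟩
  have horth := (eigenbasis hA).orthonormal.comp _ (Fin.castLE_injective hℓ)
  rw [dominantSpace, himg]
  exact (finrank_span_eq_card horth.linearIndependent).trans (Fintype.card_fin ℓ)

theorem dominantSpace_mono (hA : A.IsHermitian) {ℓ m : ℕ} (h : ℓ ≤ m) :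
    dominantSpace hA ℓ ≤ dominantSpace hA m :=
  Submodule.span_mono (Set.image_mono fun _ hi => lt_of_lt_of_le hi h)

theorem re_inner_diagOp {E : Type*} [NormedAddCommGroup E] [InnerProductSpace 𝕜 E] {ι : Type*}
    [Fintype ι] (b : OrthonormalBasis ι 𝕜 E) (d : ι → ℝ) (x : E) :
    RCLike.re (inner 𝕜 x (diagOp b d x)) = ∑ i, d i * ‖(inner 𝕜 (b i) x : 𝕜)‖ ^ 2 := by
  simp only [diagOp, sum_apply, inner_sum, smul_apply, InnerProductSpace.rankOne_apply,
    inner_smul_right, map_sum]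
  refine Finset.sum_congr rfl fun i _ => ?_
  rw [← inner_conj_symm x, RCLike.mul_conj, ← RCLike.ofReal_pow, ← RCLike.ofReal_mul,
    RCLike.ofReal_re]

/-- For ℓ = 0 the placeholder value of `eigenvalue` does no harm, since then x = 0. -/
theorem le_re_inner_of_mem_dominantSpace (hA : A.IsHermitian) {ℓ : ℕ} (hℓn : ℓ ≤ n)
    {x : EuclideanSpace 𝕜 (Fin n)} (hx : x ∈ dominantSpace hA ℓ) :
    eigenvalue hA ℓ * ‖x‖ ^ 2 ≤
      RCLike.re (inner 𝕜 x (Matrix.toEuclideanCLM (n := Fin n) (𝕜 := 𝕜) A x)) := by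
  rw [toEuclideanCLM_eq_diagOp hA, re_inner_diagOp, ← (eigenbasis hA).sum_sq_norm_inner_right x,
    Finset.mul_sum]
  refine Finset.sum_le_sum fun i _ => ?_
  by_cases hi : (i : ℕ) < ℓ
  · exact mul_le_mul_of_nonneg_right (eigenvalue_antitone hA (by omega) hi hℓn) (by positivity)
  · have h0 : inner 𝕜 (eigenbasis hA i) x = (0 : 𝕜) :=
      Submodule.inner_left_of_mem_orthogonal hx
        (eigenbasis_mem_dominantSpace_orthogonal hA (not_lt.mp hi))
    simp [h0]

theorem re_inner_le_of_mem_dominantSpace_orthogonal (hA : A.IsHermitian) {ℓ : ℕ}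
    {x : EuclideanSpace 𝕜 (Fin n)} (hx : x ∈ (dominantSpace hA ℓ)ᗮ) :
    RCLike.re (inner 𝕜 x (Matrix.toEuclideanCLM (n := Fin n) (𝕜 := 𝕜) A x)) ≤
      eigenvalue hA (ℓ + 1) * ‖x‖ ^ 2 := by
  rw [toEuclideanCLM_eq_diagOp hA, re_inner_diagOp, ← (eigenbasis hA).sum_sq_norm_inner_right x,
    Finset.mul_sum]
  refine Finset.sum_le_sum fun i _ => ?_
  by_cases hi : (i : ℕ) < ℓ
  · have h0 : inner 𝕜 (eigenbasis hA i) x = (0 : 𝕜) :=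
      Submodule.inner_right_of_mem_orthogonal (K := dominantSpace hA ℓ)
        (Submodule.subset_span ⟨i, hi, rfl⟩) hx
    simp [h0]
  · exact mul_le_mul_of_nonneg_right
      (eigenvalue_antitone hA (by omega) (by omega) (by omega)) (by positivity)

/-- A unitarily invariant norm dominates a positive multiple of the numerical radius. -/
theorem UINorm.exists_re_inner_le (N : UINorm 𝕜 n) (hn : 0 < n) :
    ∃ c : ℝ, 0 < c ∧ ∀ (M : Matrix (Fin n) (Fin n) 𝕜) (x : EuclideanSpace 𝕜 (Fin n)),
      RCLike.re (inner 𝕜 x (Matrix.toEuclideanCLM (n := Fin n) (𝕜 := 𝕜) M x)) ≤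
        N.val M / c * ‖x‖ ^ 2 := by
  set o : Fin n := ⟨0, hn⟩
  set d : Fin n → ℝ := fun i => if i = o then 1 else 0
  have hval : N.opSeminorm (diagOp (EuclideanSpace.basisFun (Fin n) 𝕜) d) =
      N.val (Matrix.diagonal fun i => (d i : 𝕜)) := by
    rw [← toEuclideanCLM_diagonal, N.opSeminorm_toEuclideanCLM]
  -- The constant is the norm of a coordinate projection of rank one, positive by definiteness of
  -- the norm.
  have hc : 0 < N.opSeminorm (diagOp (EuclideanSpace.basisFun (Fin n) 𝕜) d) := by
    refine lt_of_le_of_ne (apply_nonneg _ _) fun h0 => ?_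
    rw [hval] at h0
    have := congrFun (congrFun (N.eq_zero_of_map_eq_zero _ h0.symm) o) o
    simp [d] at this
  refine ⟨_, hc, fun M x => ?_⟩
  by_cases hx : x = 0
  · simp [hx]
  have hx' : 0 < ‖x‖ := norm_pos_iff.mpr hx
  have hu : ‖((‖x‖⁻¹ : ℝ) : 𝕜) • x‖ = 1 := by
    simp [norm_smul, hx'.ne']
  have key := N.opSeminorm_invariant.abs_inner_le (EuclideanSpace.basisFun (Fin n) 𝕜) o
    (Matrix.toEuclideanCLM (n := Fin n) (𝕜 := 𝕜) M) hu
  rw [N.opSeminorm_toEuclideanCLM, map_smul, inner_smul_left, inner_smul_right, norm_mul, norm_mul,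
    RCLike.conj_ofReal, RCLike.norm_ofReal, abs_of_pos (inv_pos.mpr hx')] at key
  rw [div_mul_eq_mul_div, le_div_iff₀ hc]
  have h1 : RCLike.re (inner 𝕜 x (Matrix.toEuclideanCLM (n := Fin n) (𝕜 := 𝕜) M x)) ≤
      ‖(inner 𝕜 x (Matrix.toEuclideanCLM (n := Fin n) (𝕜 := 𝕜) M x) : 𝕜)‖ := RCLike.re_le_norm _
  refine (mul_le_mul_of_nonneg_right h1 hc.le).trans ?_
  have h2 := mul_le_mul_of_nonneg_right key (sq_nonneg ‖x‖)
  refine le_trans (le_of_eq ?_) h2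
  field_simp
  rfl

/-- A nonzero `x` in both spaces would have ⟨x, (A - B)x⟩ ≥ (λ_ℓ(A) - λ_{m+1}(B)) ‖x‖² > ρ ‖x‖². The
case ℓ = m gives the transversality needed in `UINorm.exists_between`; ℓ = m + 1 gives Weyl's
inequality. -/
theorem eq_zero_of_mem_dominantSpace_of_mem_orthogonal (hA : A.IsHermitian) (hB : B.IsHermitian)
    {ρ : ℝ} (hρ : ∀ x, RCLike.re (inner 𝕜 x (Matrix.toEuclideanCLM (n := Fin n) (𝕜 := 𝕜) (A - B) x))
      ≤ ρ * ‖x‖ ^ 2) {ℓ m : ℕ} (hℓ : ℓ ≤ n)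
    (hgap : ρ < eigenvalue hA ℓ - eigenvalue hB (m + 1)) (x : EuclideanSpace 𝕜 (Fin n))
    (hxA : x ∈ dominantSpace hA ℓ) (hxB : x ∈ (dominantSpace hB m)ᗮ) : x = 0 := by
  by_contra hx
  have hx' : 0 < ‖x‖ ^ 2 := by
    have := norm_pos_iff.mpr hx
    positivity
  have h1 := le_re_inner_of_mem_dominantSpace hA hℓ hxA
  have h2 := re_inner_le_of_mem_dominantSpace_orthogonal hB hxB
  have h3 := hρ x
  rw [map_sub, sub_apply, inner_sub_right, map_sub] at h3
  nlinarith [mul_lt_mul_of_pos_right hgap hx']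

/-- Weyl's inequality. -/
theorem eigenvalue_le_add (hA : A.IsHermitian) (hB : B.IsHermitian)
    {ρ : ℝ} (hρ : ∀ x, RCLike.re (inner 𝕜 x (Matrix.toEuclideanCLM (n := Fin n) (𝕜 := 𝕜) (A - B) x))
      ≤ ρ * ‖x‖ ^ 2) {i : ℕ} (hi : 1 ≤ i) (hin : i ≤ n) :
    eigenvalue hA i ≤ eigenvalue hB i + ρ := by
  by_contra! hlt
  obtain ⟨m, rfl⟩ : ∃ m, i = m + 1 := ⟨i - 1, by omega⟩
  have hdisj : Disjoint (dominantSpace hA (m + 1)) (dominantSpace hB m)ᗮ :=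
    Submodule.disjoint_def.mpr
      (eq_zero_of_mem_dominantSpace_of_mem_orthogonal hA hB hρ hin (by linarith))
  -- The dimensions m + 1 and n - m add up to more than `n`.
  have h1 := Submodule.finrank_add_finrank_le_of_disjoint hdisj
  have h2 := (dominantSpace hB m).finrank_add_finrank_orthogonal
  rw [finrank_dominantSpace hA hin] at h1
  rw [finrank_dominantSpace hB (by omega)] at h2
  rw [← h2] at h1
  omega

theorem UINorm.sin_upper_le (N : UINorm 𝕜 n) (hA : A.IsHermitian) (hB : B.IsHermitian) {k : ℕ}
    (hk : 1 ≤ k) (hkn : k < n) {γ : ℝ} (hγ : 0 < γ)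
    (hgap : γ ≤ eigenvalue hA k - eigenvalue hB (k + 1)) :
    N.opSeminorm ((dominantSpace hB k)ᗮ.starProjection * (dominantSpace hA k).starProjection) ≤
      N.val (A - B) * (1 / γ) := by
  -- Basis indices start at 0 and eigenvalue indices at 1: `i < k` selects λ_1, …, λ_k of `A`, and
  -- `k ≤ i` selects λ_{k+1}, …, λ_n of `B`.
  have h := N.opSeminorm_invariant.spectral_separation (eigenbasis hA) (eigenbasis hB)
    (fun i => eigenvalue hA (i + 1)) (fun i => eigenvalue hB (i + 1)) (fun i => k ≤ (i : ℕ))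
    (fun i => (i : ℕ) < k) (α := eigenvalue hA k) (β := eigenvalue hB (k + 1)) (by linarith)
    (fun i hi => eigenvalue_antitone hA (by omega) hi hkn.le)
    (fun i hi => eigenvalue_antitone hB (by omega) (by omega) (by omega))
  rw [← toEuclideanCLM_eq_diagOp hA, ← toEuclideanCLM_eq_diagOp hB, ← map_sub,
    N.opSeminorm_toEuclideanCLM, ← starProjection_dominantSpace,
    ← starProjection_dominantSpace_orthogonal] at h
  rw [mul_one_div, le_div_iff₀ hγ, mul_comm]
  exact (mul_le_mul_of_nonneg_right hgap (apply_nonneg _ _)).trans h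

/-- The adjoint of the product in `UINorm.sin_upper_le`, with `A` and `B` exchanged. -/
theorem UINorm.sin_lower_le (N : UINorm 𝕜 n) (hA : A.IsHermitian) (hB : B.IsHermitian) {j : ℕ}
    (hj : 1 ≤ j) (hjn : j < n) {γ : ℝ} (hγ : 0 < γ)
    (hgap : γ ≤ eigenvalue hB j - eigenvalue hA (j + 1)) :
    N.opSeminorm ((dominantSpace hB j).starProjection * (dominantSpace hA j)ᗮ.starProjection) ≤
      N.val (A - B) * (1 / γ) := by
  have h := N.opSeminorm_invariant.eq_of_adjoint (M := (dominantSpace hA j)ᗮ.starProjection *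
    (dominantSpace hB j).starProjection) (M' := (dominantSpace hB j).starProjection *
    (dominantSpace hA j)ᗮ.starProjection) fun x y => by
      change inner 𝕜 ((dominantSpace hA j)ᗮ.starProjection ((dominantSpace hB j).starProjection x))
        y = inner 𝕜 x ((dominantSpace hB j).starProjection
          ((dominantSpace hA j)ᗮ.starProjection y))
      rw [Submodule.inner_starProjection_left_eq_right,
        Submodule.inner_starProjection_left_eq_right]
  rw [h]
  have hsymm : N.val (A - B) = N.val (B - A) := map_sub_rev N.toSeminorm A B
  rw [hsymm]
  exact N.sin_upper_le hB hA hj hjn hγ hgap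

end Perturbation

/-! ### Hausdorff distance of admissible sets and the condition number -/

section ConditionNumber

variable {𝕜 : Type*} [RCLike 𝕜] {n j h k : ℕ}

theorem maxQuotient_mono {𝒜 : Set (Matrix (Fin n) (Fin n) 𝕜)} (N : UINorm 𝕜 n)
    (f : 𝒜 → Set (Grass 𝕜 n h)) (A : 𝒜) : Monotone (maxQuotient N f A) := by
  intro ε₁ ε₂ hε
  refine iSup_mono fun B => iSup_le fun hB => ?_
  exact le_iSup (fun _ : 0 < N.val (A.1 - B.1) ∧ N.val (A.1 - B.1) < ε₂ =>
    hausdorffDist N (f A) (f B) / ENNReal.ofReal (N.val (A.1 - B.1))) ⟨hB.1, hB.2.trans_le hε⟩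

/-- A monotone function with values in `ℝ≥0∞` has a right limit, namely its infimum to the right. -/
theorem isConditionNumber_iInf {𝒜 : Set (Matrix (Fin n) (Fin n) 𝕜)} (N : UINorm 𝕜 n)
    (f : 𝒜 → Set (Grass 𝕜 n h)) (A : 𝒜) :
    IsConditionNumber N f A (sInf (maxQuotient N f A '' Set.Ioi 0)) :=
  (maxQuotient_mono N f A).tendsto_nhdsGT 0

/-- `γ` and `δ` bound the mixed gaps from below. That they exceed `ρ` gives transversality; their
size gives the sine bounds. For j = 0 the lower space is zero and its term disappears. -/
theorem UINorm.exists_admissible (N : UINorm 𝕜 n) (hjh : j < h) (hhk : h < k) (hkn : k < n)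
    {A B : gapSet 𝕜 n j k} (hA : A.1.IsHermitian) (hB : B.1.IsHermitian) {ρ δ γ : ℝ}
    (hρ : ∀ x, RCLike.re (inner 𝕜 x
      (Matrix.toEuclideanCLM (n := Fin n) (𝕜 := 𝕜) (A.1 - B.1) x)) ≤ ρ * ‖x‖ ^ 2)
    (hρ' : ∀ x, RCLike.re (inner 𝕜 x
      (Matrix.toEuclideanCLM (n := Fin n) (𝕜 := 𝕜) (B.1 - A.1) x)) ≤ ρ * ‖x‖ ^ 2)
    (hρ0 : 0 ≤ ρ) (hργ : ρ < γ) (hγ : γ ≤ eigenvalue hA k - eigenvalue hB (k + 1))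
    (hρδ : j ≠ 0 → ρ < δ) (hδ : j ≠ 0 → δ ≤ eigenvalue hB j - eigenvalue hA (j + 1))
    {S : Grass 𝕜 n h} (hS : S ∈ admissible 𝕜 n j h k A) :
    ∃ T ∈ admissible 𝕜 n j h k B, N.opSeminorm (T.1ᗮ.starProjection * S.1.starProjection) ≤
      N.val (A.1 - B.1) * ((if j = 0 then 0 else 1 / δ) + 1 / γ) := by
  obtain ⟨T, hjT, hTk, hrank, hT⟩ := N.exists_between
    (dominantSpace_mono hB (hjh.trans hhk).le) hS.1 hS.2
    (eq_zero_of_mem_dominantSpace_of_mem_orthogonal hA hB hρ hkn.le (hργ.trans_le hγ)) (by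
      intro y hyB hyA
      by_cases hj : j = 0
      · subst hj
        have : dominantSpace hB 0 = ⊥ := by simp [dominantSpace]
        rw [this] at hyB
        exact (Submodule.mem_bot 𝕜).mp hyB
      · exact eq_zero_of_mem_dominantSpace_of_mem_orthogonal hB hA hρ' (by omega)
          ((hρδ hj).trans_le (hδ hj)) y hyB hyA)
  refine ⟨⟨T, hrank.trans S.2⟩, ⟨hjT, hTk⟩, hT.trans ?_⟩
  rw [mul_add]
  refine add_le_add ?_ (N.sin_upper_le hA hB (by omega) hkn (hρ0.trans_lt hργ) hγ)
  split_ifs with hj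
  · subst hj
    have : dominantSpace hB 0 = ⊥ := by simp [dominantSpace]
    rw [this, Submodule.starProjection_bot, zero_mul, map_zero, mul_zero]
  · exact N.sin_lower_le hA hB (by omega) (by omega) (hρ0.trans_lt (hρδ hj)) (hδ hj)

/-- The first order error bound with gaps diminished by `t`. -/
def gapBound (j : ℕ) (δ γ t : ℝ) : ℝ :=
  (if j = 0 then 0 else 1 / (δ - t)) + 1 / (γ - t)

/-- A mixed gap differs from a gap of `A` in one eigenvalue only, so Weyl costs a single `ρ`. The
factor 2 in `hk` and `hj` ensures that the diminished gap still exceeds `ρ`. -/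
theorem hausdorffDist_admissible_le (N : UINorm 𝕜 n) (hjh : j < h) (hhk : h < k) (hkn : k < n)
    {A B : gapSet 𝕜 n j k} (hA : A.1.IsHermitian) {c : ℝ} (hc : 0 < c)
    (hN : ∀ (M : Matrix (Fin n) (Fin n) 𝕜) (x : EuclideanSpace 𝕜 (Fin n)),
      RCLike.re (inner 𝕜 x (Matrix.toEuclideanCLM (n := Fin n) (𝕜 := 𝕜) M x)) ≤
        N.val M / c * ‖x‖ ^ 2) {ρ : ℝ} (hρ : N.val (A.1 - B.1) / c ≤ ρ)
    (hk : 2 * ρ < eigenvalue hA k - eigenvalue hA (k + 1))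
    (hj : j ≠ 0 → 2 * ρ < eigenvalue hA j - eigenvalue hA (j + 1)) :
    hausdorffDist N (admissible 𝕜 n j h k A) (admissible 𝕜 n j h k B) ≤
      ENNReal.ofReal (N.val (A.1 - B.1) * gapBound j (eigenvalue hA j - eigenvalue hA (j + 1))
        (eigenvalue hA k - eigenvalue hA (k + 1)) ρ) := by
  have hB := gapSet.isHermitian B
  have hsymm : N.val (B.1 - A.1) = N.val (A.1 - B.1) := map_sub_rev N.toSeminorm B.1 A.1
  have h0 : 0 ≤ N.val (A.1 - B.1) := apply_nonneg N.toSeminorm _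
  have hρ0 : 0 ≤ ρ := (div_nonneg h0 hc.le).trans hρ
  have hAB : ∀ x, RCLike.re (inner 𝕜 x
      (Matrix.toEuclideanCLM (n := Fin n) (𝕜 := 𝕜) (A.1 - B.1) x)) ≤ ρ * ‖x‖ ^ 2 := fun x =>
    (hN _ x).trans (mul_le_mul_of_nonneg_right hρ (by positivity))
  have hBA : ∀ x, RCLike.re (inner 𝕜 x
      (Matrix.toEuclideanCLM (n := Fin n) (𝕜 := 𝕜) (B.1 - A.1) x)) ≤ ρ * ‖x‖ ^ 2 := fun x => by
    refine (hN _ x).trans (mul_le_mul_of_nonneg_right ?_ (by positivity))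
    rwa [hsymm]
  have wAB := fun i => eigenvalue_le_add hA hB hAB (i := i)
  have wBA := fun i => eigenvalue_le_add hB hA hBA (i := i)
  refine max_le (iSup₂_le fun S hS => ?_) (iSup₂_le fun T hT => ?_)
  · obtain ⟨T, hT, hST⟩ := N.exists_admissible hjh hhk hkn hA hB hAB hBA hρ0
      (γ := eigenvalue hA k - eigenvalue hA (k + 1) - ρ)
      (δ := eigenvalue hA j - eigenvalue hA (j + 1) - ρ) (by linarith)
      (by linarith [wBA (k + 1) (by omega) (by omega)]) (fun h => by linarith [hj h])
      (fun h => by linarith [wAB j (by omega) (by omega)]) hS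
    refine (iInf₂_le T hT).trans (ENNReal.ofReal_le_ofReal ?_)
    rwa [(N.val_sinTheta S.2 T.2).2]
  -- With the roles exchanged, the mixed gaps are λ_k(B) - λ_{k+1}(A) and λ_j(A) - λ_{j+1}(B). They
  -- are again compared with the gaps of `A`, so no gap of `B` enters.
  · obtain ⟨S, hS, hST⟩ := N.exists_admissible hjh hhk hkn hB hA hBA hAB hρ0
      (γ := eigenvalue hA k - eigenvalue hA (k + 1) - ρ)
      (δ := eigenvalue hA j - eigenvalue hA (j + 1) - ρ) (by linarith)
      (by linarith [wAB k (by omega) (by omega)]) (fun h => by linarith [hj h])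
      (fun h => by linarith [wBA (j + 1) (by omega) (by omega)]) hT
    refine (iInf₂_le S hS).trans (ENNReal.ofReal_le_ofReal ?_)
    rw [hsymm] at hST
    rwa [(N.val_sinTheta S.2 T.2).1]

theorem tendsto_gapBound {δ γ c : ℝ} (hδ : j ≠ 0 → 0 < δ) (hγ : 0 < γ) :
    Tendsto (fun ε : ℝ => ENNReal.ofReal (gapBound j δ γ (ε / c))) (𝓝[>] 0)
      (𝓝 (ENNReal.ofReal ((if j = 0 then 0 else 1 / δ) + 1 / γ))) := by
  have hcont : ContinuousAt (fun ε : ℝ => gapBound j δ γ (ε / c)) 0 := by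
    unfold gapBound
    refine ContinuousAt.add ?_ ?_
    · by_cases hj : j = 0
      · simpa [hj] using continuousAt_const
      · simp only [if_neg hj]
        refine continuousAt_const.div (by fun_prop) ?_
        simpa using (hδ hj).ne'
    · refine continuousAt_const.div (by fun_prop) ?_
      simpa using hγ.ne'
  have := (ENNReal.continuous_ofReal.continuousAt.comp hcont).tendsto.mono_left
    (nhdsWithin_le_nhds (s := Set.Ioi 0))
  simpa [gapBound, Function.comp_def] using this

end ConditionNumber

end

end LambdaAdm

/-- The condition number at `A` of the map `B ↦ Λ-adm_h(B)` exists and is bounded by the sum of the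
inverses of the eigenvalue gaps at `j` and `k`; the first term is omitted if `j = 0`. -/
theorem mainTheorem4 {𝕜 : Type*} [RCLike 𝕜] (n j h k : ℕ) (hjh : j < h) (hhk : h < k)
    (hkn : k < n) (N : LambdaAdm.UINorm 𝕜 n) (A : LambdaAdm.gapSet 𝕜 n j k)
    (hA : A.1.IsHermitian) :
    ∃ κ : ℝ≥0∞,
      LambdaAdm.IsConditionNumber N (LambdaAdm.admissible 𝕜 n j h k) A κ ∧
      κ ≤ ENNReal.ofReal
        ((if j = 0 then 0
          else 1 / (LambdaAdm.eigenvalue hA j - LambdaAdm.eigenvalue hA (j + 1))) +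
        1 / (LambdaAdm.eigenvalue hA k - LambdaAdm.eigenvalue hA (k + 1))) := by
  obtain ⟨c, hc, hN⟩ := N.exists_re_inner_le (by omega)
  obtain ⟨_, hgapj, hgapk⟩ := A.2
  have hk : 0 < LambdaAdm.eigenvalue hA k - LambdaAdm.eigenvalue hA (k + 1) :=
    sub_pos.mpr (hgapk.resolve_left (by omega))
  have hj : j ≠ 0 → 0 < LambdaAdm.eigenvalue hA j - LambdaAdm.eigenvalue hA (j + 1) :=
    fun h0 => sub_pos.mpr (hgapj.resolve_left h0)
  refine ⟨_, LambdaAdm.isConditionNumber_iInf N _ A, ?_⟩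
  refine le_of_tendsto_of_tendsto (LambdaAdm.isConditionNumber_iInf N _ A)
    (LambdaAdm.tendsto_gapBound (c := c) hj hk) ?_
  have small : ∀ g : ℝ, 0 < g → ∀ᶠ ε : ℝ in 𝓝[>] 0, 2 * (ε / c) < g := fun g hg => by
    have : Tendsto (fun ε : ℝ => 2 * (ε / c)) (𝓝 0) (𝓝 (2 * (0 / c))) :=
      Continuous.tendsto (by fun_prop) 0
    exact (this.mono_left nhdsWithin_le_nhds).eventually_lt_const (by simpa using hg)
  have smallj : ∀ᶠ ε : ℝ in 𝓝[>] 0, j ≠ 0 →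
      2 * (ε / c) < LambdaAdm.eigenvalue hA j - LambdaAdm.eigenvalue hA (j + 1) := by
    by_cases h0 : j = 0
    · exact Eventually.of_forall fun _ h => absurd h0 h
    · exact (small _ (hj h0)).mono fun _ h _ => h
  filter_upwards [small _ hk, smallj] with ε hεk hεj
  refine iSup_le fun B => iSup_le fun hB => ?_
  refine ENNReal.div_le_of_le_mul ?_
  rw [← ENNReal.ofReal_mul' hB.1.le, mul_comm]
  -- Taking ρ = ε / c makes the bound uniform over all `B` in the supremum.
  exact LambdaAdm.hausdorffDist_admissible_le N hjh hhk hkn hA hc hN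
    (div_le_div_of_nonneg_right hB.2.le hc.le) hεk hεj
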